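/- Let $X$ be a compact metric space, $T:X\to X$ a continuous map, and $d\ge 1$. Let $\mathcal M(X,T)$ be the set of $T$-invariant Borel probability measures on $X$ and $\mathcal M^e(X,T)\subset\mathcal M(X,T)$ the subset of ergodic ones, both with the weak-$*$ topology. Equip the space $C(X,GL_d(\mathbb R))$ of continuous maps $X\to GL_d(\mathbb R)$ with the metric $\rho(A,B)=\max_{x\in X}\{\|A(x)-B(x)\|+\|A(x)^{-1}-B(x)^{-1}\|\}$, where $\|\cdot\|$ is the Euclidean operator norm. For $A\in C(X,GL_d(\mathbb R))$ and $n\ge1$ put $A(n,x)=A(T^{n-1}x)\cdots A(Tx)A(x)$, and let $$\beta(A)=\sup_{\mu\in\mathcal M(X,T)}\ \inf_{n\ge1}\frac1n\int\log\|A(n,x)\|\,d\mu(x),$$ $$\mathcal M_{\max}(A)=\Big\{\mu\in\mathcal M(X,T):\ \inf_{n\ge1}\frac1n\int\log\|A(n,x)\|\,d\mu(x)=\beta(A)\Big\}.$$ If $\mathcal F$ is a dense subset of $C(X,GL_d(\mathbb R))$, then $\mathcal M^e(X,T)\cap\bigcup_{A\in\mathcal F}\mathcal M_{\max}(A)$ is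 dense in $\mathcal M^e(X,T)$. -/

import Mathlib

open MeasureTheory

noncomputable section

namespace LyapunovOpt

/-- The operator norm of a real `d × d` matrix acting on Euclidean space `ℝ^d`. -/
def opNorm {d : ℕ} (M : Matrix (Fin d) (Fin d) ℝ) : ℝ :=
  ‖Matrix.toEuclideanCLM (n := Fin d) (𝕜 := ℝ) M‖

/-- The metric `ρ(A, B) = max_x (‖A(x) - B(x)‖ + ‖A(x)⁻¹ - B(x)⁻¹‖)` on `C(X, GL_d(ℝ))`,
for compact `X` (so that the supremum is that of a continuous function on a compact space). -/
def rho {X : Type*} [TopologicalSpace X] {d : ℕ} (A B : C(X, GL (Fin d) ℝ)) : ℝ :=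
  ⨆ x : X,
    (opNorm ((A x : Matrix (Fin d) (Fin d) ℝ) - (B x : Matrix (Fin d) (Fin d) ℝ)) +
      opNorm (((A x)⁻¹ : GL (Fin d) ℝ) - ((B x)⁻¹ : GL (Fin d) ℝ) : Matrix (Fin d) (Fin d) ℝ))

/-- `𝓕` is dense in `C(X, GL_d(ℝ))` with respect to the metric `ρ`. -/
def RhoDense {X : Type*} [TopologicalSpace X] {d : ℕ} (𝓕 : Set C(X, GL (Fin d) ℝ)) : Prop :=
  ∀ A : C(X, GL (Fin d) ℝ), ∀ ε : ℝ, 0 < ε → ∃ B ∈ 𝓕, rho A B < ε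

/-- The cocycle `A(n, x) = A(T^{n-1} x) ⋯ A(T x) A(x)`, with `A(0, x) = 1`. -/
def cocycle {X : Type*} [TopologicalSpace X] {d : ℕ} (T : X → X) (A : C(X, GL (Fin d) ℝ)) :
    ℕ → X → GL (Fin d) ℝ
  | 0, _ => 1
  | n + 1, x => A (T^[n] x) * cocycle T A n x

/-- The set `𝓜(X, T)` of `T`-invariant Borel probability measures; as a subset of
`ProbabilityMeasure X` it carries the weak-* topology. -/
def invariantMeasures {X : Type*} [MeasurableSpace X] (T : X → X) :
    Set (ProbabilityMeasure X) :=
  {μ | MeasurePreserving T (μ : Measure X) (μ : Measure X)}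

/-- The set `𝓜^e(X, T)` of `T`-ergodic (invariant) Borel probability measures. -/
def ergodicMeasures {X : Type*} [MeasurableSpace X] (T : X → X) :
    Set (ProbabilityMeasure X) :=
  {μ | Ergodic T (μ : Measure X)}

/-- The top Lyapunov exponent of `A` with respect to `μ`:
`inf_{n ≥ 1} (1/n) ∫ log ‖A(n, x)‖ dμ(x)`. -/
def lyapunovExponent {X : Type*} [TopologicalSpace X] [MeasurableSpace X] {d : ℕ}
    (T : X → X) (A : C(X, GL (Fin d) ℝ)) (μ : ProbabilityMeasure X) : ℝ :=
  ⨅ n : ℕ+, (1 / ((n : ℕ) : ℝ)) *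
    ∫ x, Real.log (opNorm (cocycle T A n x : Matrix (Fin d) (Fin d) ℝ)) ∂(μ : Measure X)

/-- The maximum ergodic average
`β(A) = sup_{μ ∈ 𝓜(X, T)} inf_{n ≥ 1} (1/n) ∫ log ‖A(n, x)‖ dμ(x)`. -/
def maxErgodicAverage {X : Type*} [TopologicalSpace X] [MeasurableSpace X] {d : ℕ}
    (T : X → X) (A : C(X, GL (Fin d) ℝ)) : ℝ :=
  ⨆ μ : invariantMeasures T, lyapunovExponent T A μ

/-- The set `𝓜_max(A)` of maximising measures for `A`. -/
def maximisingMeasures {X : Type*} [TopologicalSpace X] [MeasurableSpace X] {d : ℕ}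
    (T : X → X) (A : C(X, GL (Fin d) ℝ)) : Set (ProbabilityMeasure X) :=
  {μ | μ ∈ invariantMeasures T ∧ lyapunovExponent T A μ = maxErgodicAverage T A}

end LyapunovOpt

end

/-! An ergodic `μ` is an extreme point of the compact convex set of invariant measures. Hence, for a
neighbourhood `U` of `μ`, some continuous `f` and constant `c` satisfy `∫ f dν ≤ c < ∫ f dμ` for all
invariant `ν` outside `U` (`exists_separating_continuousMap`). The scalar cocycle `exp f • 1` has
exponent `∫ f dν`. A generator `B ∈ 𝓕` that is `rho`-close to it satisfies `‖B‖ ≤ exp (f + δ)` and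
`‖B⁻¹‖ ≤ exp (-f + δ)`, so its exponents differ from `∫ f dν` by at most `δ`, uniformly in `ν`. When
`2δ` is below the gap, all maximising measures of `B` lie in `U`, and an ergodic one exists
(`exists_ergodic_isMaxOn`). -/

namespace LyapunovOpt

open Set Filter Topology

/-! ### Convex hulls and separation of extreme points. -/

section Convex

variable {E : Type*} [AddCommGroup E] [Module ℝ E] [TopologicalSpace E]
  [IsTopologicalAddGroup E] [ContinuousSMul ℝ E]

theorem isCompact_convexJoin {s t : Set E} (hs : IsCompact s) (ht : IsCompact t) :
    IsCompact (convexJoin ℝ s t) := by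
  have h : convexJoin ℝ s t =
      (fun p : ℝ × E × E => (1 - p.1) • p.2.1 + p.1 • p.2.2) '' (Icc 0 1 ×ˢ s ×ˢ t) := by
    ext x
    simp only [mem_convexJoin, segment_eq_image, mem_image, mem_prod, Prod.exists]
    constructor
    · rintro ⟨a, ha, b, hb, θ, hθ, rfl⟩
      exact ⟨θ, a, b, ⟨hθ, ha, hb⟩, rfl⟩
    · rintro ⟨θ, a, b, ⟨hθ, ha, hb⟩, rfl⟩
      exact ⟨a, ha, b, hb, θ, hθ, rfl⟩
  rw [h]
  exact (isCompact_Icc.prod (hs.prod ht)).image (by fun_prop)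

theorem isCompact_convexHull_union {s t : Set E} (hs : IsCompact (convexHull ℝ s))
    (ht : IsCompact (convexHull ℝ t)) : IsCompact (convexHull ℝ (s ∪ t)) := by
  rcases s.eq_empty_or_nonempty with rfl | hs'
  · simpa using ht
  rcases t.eq_empty_or_nonempty with rfl | ht'
  · simpa using hs
  rw [convexHull_union hs' ht']
  exact isCompact_convexJoin hs ht

theorem isCompact_convexHull_biUnion {ι : Type*} (I : Finset ι) (C : ι → Set E)
    (hC : ∀ i ∈ I, IsCompact (convexHull ℝ (C i))) :
    IsCompact (convexHull ℝ (⋃ i ∈ I, C i)) := by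
  classical
  induction I using Finset.induction_on with
  | empty => simp
  | insert i I _ ih =>
    rw [Finset.set_biUnion_insert]
    exact isCompact_convexHull_union (hC i (Finset.mem_insert_self _ _))
      (ih fun j hj => hC j (Finset.mem_insert_of_mem hj))

/-- An extreme point of a compact convex set can be strictly separated from any compact subset
not containing it. -/
theorem exists_separation_of_mem_extremePoints [T2Space E] [LocallyConvexSpace ℝ E]
    {S K : Set E} (hS : IsCompact S) (hSc : Convex ℝ S) (hK : IsCompact K) (hKS : K ⊆ S) {x : E}
    (hx : x ∈ S.extremePoints ℝ) (hxK : x ∉ K) :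
    ∃ (f : E →L[ℝ] ℝ) (c : ℝ), c < f x ∧ ∀ y ∈ K, f y ≤ c := by
  have h : ∀ y ∈ K, ∃ (f : E →L[ℝ] ℝ) (c : ℝ), f x < c ∧ c < f y := fun y hy => by
    obtain ⟨f, hf⟩ := geometric_hahn_banach_point_point (show x ≠ y by rintro rfl; exact hxK hy)
    obtain ⟨c, hc⟩ := exists_between hf
    exact ⟨f, c, hc⟩
  choose! f c hx' hy' using h
  obtain ⟨I, hIK, hI⟩ := hK.elim_nhds_subcover (fun y => {z | c y < f y z}) fun y hy =>
    (isOpen_lt continuous_const (f y).continuous).mem_nhds (hy' y hy)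
  -- Finitely many closed half-space slices of `S` cover `K` and miss `x`. Each slice is compact and
  -- convex, so the hull of their union is compact.
  set C : E → Set E := fun y => S ∩ {z | c y ≤ f y z}
  have hCc : ∀ y, Convex ℝ (C y) := fun y =>
    hSc.inter (convex_halfSpace_ge (f y).toLinearMap.isLinear (c y))
  have hH : IsCompact (convexHull ℝ (⋃ y ∈ I, C y)) := by
    refine isCompact_convexHull_biUnion I C fun y _ => ?_
    rw [(hCc y).convexHull_eq]
    exact hS.inter_right (isClosed_le continuous_const (f y).continuous)
  have hHS : convexHull ℝ (⋃ y ∈ I, C y) ⊆ S :=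
    convexHull_min (iUnion₂_subset fun _ _ => inter_subset_left) hSc
  -- Being extreme in `S`, `x` would also be extreme in the smaller hull, hence would lie in one of
  -- the slices.
  have hxH : x ∉ convexHull ℝ (⋃ y ∈ I, C y) := fun hxm => by
    have := extremePoints_convexHull_subset
      (inter_extremePoints_subset_extremePoints_of_subset hHS ⟨hxm, hx⟩)
    obtain ⟨y, hy, hxy⟩ := mem_iUnion₂.1 this
    exact absurd hxy.2 (not_le.2 (hx' y (hIK y hy)))
  obtain ⟨g, u, hu, hxu⟩ :=
    geometric_hahn_banach_closed_point (convex_convexHull ℝ _) hH.isClosed hxH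
  refine ⟨g, u, hxu, fun y hy => (hu y (subset_convexHull ℝ _ ?_)).le⟩
  obtain ⟨z, hz, hyz⟩ := mem_iUnion₂.1 (hI hy)
  have hyz' : c z < f z y := hyz
  exact mem_iUnion₂.2 ⟨z, hz, hKS hy, hyz'.le⟩

end Convex
open scoped ENNReal

/-! ### Invariant measures inside the weak-* dual of `C(X, ℝ)`. -/

section Integral

variable {X : Type*} [MetricSpace X] [CompactSpace X] [MeasurableSpace X] [BorelSpace X]

theorem integrable_continuousMap (μ : Measure X) [IsFiniteMeasure μ] (f : C(X, ℝ)) :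
    Integrable f μ :=
  f.continuous.integrable_of_hasCompactSupport (HasCompactSupport.of_compactSpace _)

omit [CompactSpace X] in
theorem measure_ext_of_integral_continuousMap {μ ν : Measure X} [IsFiniteMeasure μ]
    [IsFiniteMeasure ν] (h : ∀ f : C(X, ℝ), ∫ x, f x ∂μ = ∫ x, f x ∂ν) : μ = ν :=
  ext_of_forall_integral_eq_of_IsFiniteMeasure fun f => h f.toContinuousMap

omit [MetricSpace X] [CompactSpace X] [BorelSpace X] in
theorem abs_integral_le (μ : ProbabilityMeasure X) {f : X → ℝ} {C : ℝ} (hf : ∀ x, |f x| ≤ C) :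
    |∫ x, f x ∂(μ : Measure X)| ≤ C := by
  simpa using norm_integral_le_of_norm_le_const (μ := (μ : Measure X)) (f := f) (ae_of_all _ hf)

instance : LocallyConvexSpace ℝ (WeakDual ℝ C(X, ℝ)) :=
  inferInstanceAs (LocallyConvexSpace ℝ (WeakBilin (topDualPairing ℝ C(X, ℝ))))

omit [CompactSpace X] [MeasurableSpace X] [BorelSpace X] in
/-- Every weak-* continuous functional on the dual of `C(X, ℝ)` is an evaluation. -/
theorem exists_eval_eq (φ : WeakDual ℝ C(X, ℝ) →L[ℝ] ℝ) : ∃ g : C(X, ℝ), ∀ y, φ y = y g := by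
  obtain ⟨g, hg⟩ := LinearMap.dualEmbedding_surjective (topDualPairing ℝ C(X, ℝ)) φ
  exact ⟨g, fun y => (DFunLike.congr_fun hg y).symm⟩

/-- Integration against a probability measure, as an element of the dual of `C(X, ℝ)`. -/
noncomputable def integralDual (μ : ProbabilityMeasure X) : WeakDual ℝ C(X, ℝ) :=
  StrongDual.toWeakDual <| LinearMap.mkContinuous
    { toFun := fun f : C(X, ℝ) => ∫ x, f x ∂(μ : Measure X)
      map_add' := fun f g =>
        integral_add (integrable_continuousMap _ f) (integrable_continuousMap _ g)
      map_smul' := fun c f => integral_const_mul c _ } 1 fun f => by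
    rw [one_mul]
    exact abs_integral_le μ f.norm_coe_le_norm

theorem continuous_integralDual : Continuous (integralDual (X := X)) :=
  WeakDual.continuous_of_continuous_eval fun f =>
    ProbabilityMeasure.continuous_integral_continuousMap f

theorem integralDual_injective : Function.Injective (integralDual (X := X)) := fun μ ν h =>
  Subtype.ext <| show (μ : Measure X) = ν from measure_ext_of_integral_continuousMap fun f =>
    (DFunLike.congr_fun h f : integralDual μ f = integralDual ν f)

theorem integral_convexCombo {μ ν₁ ν₂ : Measure X} [IsFiniteMeasure ν₁] [IsFiniteMeasure ν₂]
    {a b : ℝ≥0∞} (ha : a ≠ ∞) (hb : b ≠ ∞) (h : a • ν₁ + b • ν₂ = μ) (f : C(X, ℝ)) :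
    ∫ x, f x ∂μ = a.toReal * ∫ x, f x ∂ν₁ + b.toReal * ∫ x, f x ∂ν₂ := by
  rw [← h, integral_add_measure ((integrable_continuousMap ν₁ f).smul_measure ha)
    ((integrable_continuousMap ν₂ f).smul_measure hb), integral_smul_measure,
    integral_smul_measure, smul_eq_mul, smul_eq_mul]

omit [MetricSpace X] [CompactSpace X] [BorelSpace X] in
/-- Convex combinations of probability measures. -/
theorem exists_convexCombo (ν₁ ν₂ : ProbabilityMeasure X) {a b : ℝ} (ha : 0 ≤ a) (hb : 0 ≤ b)
    (hab : a + b = 1) : ∃ ν : ProbabilityMeasure X,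
      ENNReal.ofReal a • (ν₁ : Measure X) + ENNReal.ofReal b • (ν₂ : Measure X) = ν :=
  ⟨⟨ENNReal.ofReal a • (ν₁ : Measure X) + ENNReal.ofReal b • (ν₂ : Measure X), ⟨by
    simp [← ENNReal.ofReal_add ha hb, hab]⟩⟩, rfl⟩

theorem integralDual_convexCombo {ν ν₁ ν₂ : ProbabilityMeasure X} {a b : ℝ} (ha : 0 ≤ a)
    (hb : 0 ≤ b)
    (h : ENNReal.ofReal a • (ν₁ : Measure X) + ENNReal.ofReal b • (ν₂ : Measure X) = ν) :
    integralDual ν = a • integralDual ν₁ + b • integralDual ν₂ := by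
  refine DFunLike.ext _ _ fun f => ?_
  have := integral_convexCombo ENNReal.ofReal_ne_top ENNReal.ofReal_ne_top h f
  rw [ENNReal.toReal_ofReal ha, ENNReal.toReal_ofReal hb] at this
  exact this

variable {T : X → X}

theorem isCompact_invariantMeasures (hT : Continuous T) :
    IsCompact (invariantMeasures T) := by
  refine IsClosed.isCompact ?_
  have h : invariantMeasures T = {μ | μ.map hT.measurable.aemeasurable = μ} := by
    ext μ
    refine ⟨fun h => Subtype.ext h.map_eq, fun h => ⟨hT.measurable, ?_⟩⟩
    exact congrArg Subtype.val h
  rw [h]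
  exact isClosed_eq (ProbabilityMeasure.continuous_map hT) continuous_id

omit [MetricSpace X] [CompactSpace X] [BorelSpace X] in
theorem invariantMeasures_convexCombo {ν ν₁ ν₂ : ProbabilityMeasure X} {a b : ℝ≥0∞}
    (h₁ : ν₁ ∈ invariantMeasures T) (h₂ : ν₂ ∈ invariantMeasures T)
    (h : a • (ν₁ : Measure X) + b • (ν₂ : Measure X) = ν) : ν ∈ invariantMeasures T := by
  change MeasurePreserving T (ν : Measure X) ν
  rw [← h]
  exact (h₁.smul_measure a).add_measure (h₂.smul_measure b)

omit [CompactSpace X] in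
theorem integral_iterate_of_invariant (hT : Continuous T) {ν : ProbabilityMeasure X}
    (hν : ν ∈ invariantMeasures T) (f : C(X, ℝ)) (n : ℕ) :
    ∫ x, f (T^[n] x) ∂(ν : Measure X) = ∫ x, f x ∂(ν : Measure X) := by
  have h : MeasurePreserving T^[n] (ν : Measure X) ν := MeasurePreserving.iterate hν n
  conv_rhs => rw [← h.map_eq]
  exact (integral_map (hT.iterate n).measurable.aemeasurable
    f.continuous.aestronglyMeasurable).symm

theorem integral_birkhoffSum_of_invariant (hT : Continuous T) {ν : ProbabilityMeasure X}
    (hν : ν ∈ invariantMeasures T) (f : C(X, ℝ)) (n : ℕ) :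
    ∫ x, birkhoffSum T f n x ∂(ν : Measure X) = n * ∫ x, f x ∂(ν : Measure X) := by
  simp only [birkhoffSum]
  have hi : ∀ i ∈ Finset.range n, Integrable (fun x => f (T^[i] x)) (ν : Measure X) :=
    fun i _ => integrable_continuousMap _ (f.comp ⟨T^[i], hT.iterate i⟩)
  rw [integral_finsetSum _ hi]
  simp [integral_iterate_of_invariant hT hν f]

/-- Injectivity of `integralDual` pulls a real convex decomposition back to measures with `ℝ≥0∞`
weights, where `Ergodic.mem_extremePoints` applies. -/
theorem mem_extremePoints_of_ergodic {μ : ProbabilityMeasure X} (hμ : μ ∈ ergodicMeasures T) :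
    integralDual μ ∈ (integralDual '' invariantMeasures T).extremePoints ℝ := by
  refine mem_extremePoints_iff_left.2 ⟨⟨μ, hμ.toMeasurePreserving, rfl⟩, ?_⟩
  rintro _ ⟨ν₁, h₁, rfl⟩ _ ⟨ν₂, h₂, rfl⟩ ⟨a, b, ha, hb, hab, h⟩
  obtain ⟨ν, hν⟩ := exists_convexCombo ν₁ ν₂ ha.le hb.le hab
  obtain rfl : ν = μ := integralDual_injective ((integralDual_convexCombo ha.le hb.le hν).trans h)
  have := (mem_extremePoints_iff_left.1 (Ergodic.mem_extremePoints hμ)).2 ν₁ ⟨h₁, inferInstance⟩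
    ν₂ ⟨h₂, inferInstance⟩ ⟨ENNReal.ofReal a, ENNReal.ofReal b, by simpa, by simpa,
      by rw [← ENNReal.ofReal_add ha.le hb.le, hab, ENNReal.ofReal_one], hν⟩
  exact congrArg _ (Subtype.ext this)

/-- An ergodic measure can be strictly separated from the invariant measures outside a given
neighbourhood by the integral of a continuous function. -/
theorem exists_separating_continuousMap (hT : Continuous T) {μ : ProbabilityMeasure X}
    (hμ : μ ∈ ergodicMeasures T) {U : Set (ProbabilityMeasure X)} (hU : IsOpen U) (hμU : μ ∈ U) :
    ∃ (f : C(X, ℝ)) (c : ℝ), c < ∫ x, f x ∂(μ : Measure X) ∧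
      ∀ ν ∈ invariantMeasures T, c < ∫ x, f x ∂(ν : Measure X) → ν ∈ U := by
  have hM := isCompact_invariantMeasures hT
  have hconv : Convex ℝ (integralDual '' invariantMeasures T) := by
    rintro _ ⟨ν₁, h₁, rfl⟩ _ ⟨ν₂, h₂, rfl⟩ a b ha hb hab
    obtain ⟨ν, hν⟩ := exists_convexCombo ν₁ ν₂ ha hb hab
    exact ⟨ν, invariantMeasures_convexCombo h₁ h₂ hν, integralDual_convexCombo ha hb hν⟩
  obtain ⟨φ, c, hc, hφ⟩ := exists_separation_of_mem_extremePoints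
    (hM.image continuous_integralDual) hconv ((hM.diff hU).image continuous_integralDual)
    (image_mono sdiff_subset) (mem_extremePoints_of_ergodic hμ) (by
      rintro ⟨ν, hν, h⟩
      exact hν.2 (integralDual_injective h ▸ hμU))
  obtain ⟨f, hf⟩ := exists_eval_eq φ
  refine ⟨f, c, by simpa only [hf] using! hc, fun ν hν h => ?_⟩
  by_contra hνU
  have := hφ _ (mem_image_of_mem _ ⟨hν, hνU⟩)
  rw [hf] at this
  exact absurd h (not_lt.2 this)

end Integral

/-! ### Subadditive sequences near Birkhoff sums, and their ergodic maximisers. -/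

section Potential

variable {X : Type*} [MetricSpace X] [CompactSpace X] [MeasurableSpace X] [BorelSpace X]
  {T : X → X}

/-- A subadditive sequence of continuous functions over `T` that stays within `n * δ` of the
Birkhoff sums of a continuous function `f`. -/
structure IsNearBirkhoff (T : X → X) (g : ℕ → C(X, ℝ)) (f : C(X, ℝ)) (δ : ℝ) : Prop where
  subadditive : ∀ m n x, g (m + n) x ≤ g m (T^[n] x) + g n x
  near : ∀ n x, |g n x - birkhoffSum T f n x| ≤ n * δ

/-- The asymptotic average `inf_{n ≥ 1} (1/n) ∫ g n dν`. -/
noncomputable def asympAverage (g : ℕ → C(X, ℝ)) (ν : ProbabilityMeasure X) : ℝ :=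
  ⨅ n : ℕ+, (1 / ((n : ℕ) : ℝ)) * ∫ x, g n x ∂(ν : Measure X)

variable {g : ℕ → C(X, ℝ)} {f : C(X, ℝ)} {δ : ℝ}

namespace IsNearBirkhoff

theorem abs_integral_sub_le (hT : Continuous T) (hg : IsNearBirkhoff T g f δ)
    {ν : ProbabilityMeasure X} (hν : ν ∈ invariantMeasures T) (n : ℕ) :
    |∫ x, g n x ∂(ν : Measure X) - n * ∫ x, f x ∂(ν : Measure X)| ≤ n * δ := by
  rw [← integral_birkhoffSum_of_invariant hT hν f n, ← integral_sub]
  · exact abs_integral_le ν (hg.near n)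
  · exact integrable_continuousMap _ _
  · exact integrable_finsetSum _ fun i _ =>
      integrable_continuousMap _ (f.comp ⟨T^[i], hT.iterate i⟩)

theorem abs_div_sub_le (hT : Continuous T) (hg : IsNearBirkhoff T g f δ)
    {ν : ProbabilityMeasure X} (hν : ν ∈ invariantMeasures T) {n : ℕ} (hn : 0 < n) :
    |(∫ x, g n x ∂(ν : Measure X)) / n - ∫ x, f x ∂(ν : Measure X)| ≤ δ := by
  have hn' : (0 : ℝ) < n := by exact_mod_cast hn
  have := hg.abs_integral_sub_le hT hν n
  rw [div_sub' hn'.ne', abs_div, abs_of_pos hn', div_le_iff₀ hn', mul_comm δ]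
  exact this

theorem delta_nonneg (hT : Continuous T) (hg : IsNearBirkhoff T g f δ)
    {ν : ProbabilityMeasure X} (hν : ν ∈ invariantMeasures T) : 0 ≤ δ :=
  (abs_nonneg _).trans (hg.abs_div_sub_le hT hν one_pos)

theorem bddBelow (hT : Continuous T) (hg : IsNearBirkhoff T g f δ)
    {ν : ProbabilityMeasure X} (hν : ν ∈ invariantMeasures T) :
    BddBelow (range fun n : ℕ+ => (1 / ((n : ℕ) : ℝ)) * ∫ x, g n x ∂(ν : Measure X)) := by
  refine ⟨∫ x, f x ∂(ν : Measure X) - δ, ?_⟩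
  rintro _ ⟨n, rfl⟩
  have := (abs_le.1 (hg.abs_div_sub_le hT hν n.pos)).1
  simp only [one_div_mul_eq_div]
  linarith

/-- Fekete's lemma: invariance makes the integrals subadditive in `n`, so the infimum is a limit. -/
theorem tendsto (hT : Continuous T) (hg : IsNearBirkhoff T g f δ)
    {ν : ProbabilityMeasure X} (hν : ν ∈ invariantMeasures T) :
    Tendsto (fun n : ℕ => (∫ x, g n x ∂(ν : Measure X)) / n) atTop (𝓝 (asympAverage g ν)) := by
  have hsub : Subadditive fun n : ℕ => ∫ x, g n x ∂(ν : Measure X) := fun m n => by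
    have hi : Integrable (fun x => g m (T^[n] x)) (ν : Measure X) :=
      integrable_continuousMap _ ((g m).comp ⟨T^[n], hT.iterate n⟩)
    dsimp only
    rw [← integral_iterate_of_invariant hT hν (g m) n,
      ← integral_add hi (integrable_continuousMap _ _)]
    exact integral_mono (integrable_continuousMap _ _) (hi.add (integrable_continuousMap _ _))
      (hg.subadditive m n)
  have hbdd : BddBelow (range fun n : ℕ => (∫ x, g n x ∂(ν : Measure X)) / n) := by
    -- The term `n = 0` is `0` by the division convention, so the bound must be nonpositive.
    refine ⟨-(|∫ x, f x ∂(ν : Measure X)| + δ), ?_⟩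
    rintro _ ⟨n, rfl⟩
    have h0 := hg.delta_nonneg hT hν
    rcases n.eq_zero_or_pos with rfl | hn
    · simp only [Nat.cast_zero, div_zero]
      have := abs_nonneg (∫ x, f x ∂(ν : Measure X))
      linarith
    · have := (abs_le.1 (hg.abs_div_sub_le hT hν hn)).1
      have := neg_abs_le (∫ x, f x ∂(ν : Measure X))
      dsimp only
      linarith
  convert hsub.tendsto_lim hbdd using 2
  rw [Subadditive.lim, asympAverage, iInf]
  congr 1
  ext y
  simp only [mem_range, mem_image, mem_Ici, one_div_mul_eq_div]
  exact ⟨fun ⟨n, h⟩ => ⟨n, n.pos, h⟩, fun ⟨n, hn, h⟩ => ⟨⟨n, hn⟩, h⟩⟩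

theorem abs_asympAverage_sub_le (hT : Continuous T) (hg : IsNearBirkhoff T g f δ)
    {ν : ProbabilityMeasure X} (hν : ν ∈ invariantMeasures T) :
    |asympAverage g ν - ∫ x, f x ∂(ν : Measure X)| ≤ δ :=
  le_of_tendsto ((hg.tendsto hT hν).sub_const _).abs <|
    (eventually_gt_atTop 0).mono fun _ hn => hg.abs_div_sub_le hT hν hn

/-- An infimum of affine functions is only concave; the limit form makes it affine. -/
theorem asympAverage_convexCombo (hT : Continuous T) (hg : IsNearBirkhoff T g f δ)
    {ν ν₁ ν₂ : ProbabilityMeasure X} (h₁ : ν₁ ∈ invariantMeasures T)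
    (h₂ : ν₂ ∈ invariantMeasures T) {a b : ℝ≥0∞} (ha : a ≠ ∞) (hb : b ≠ ∞)
    (h : a • (ν₁ : Measure X) + b • (ν₂ : Measure X) = ν) :
    asympAverage g ν = a.toReal * asympAverage g ν₁ + b.toReal * asympAverage g ν₂ := by
  refine tendsto_nhds_unique (hg.tendsto hT (invariantMeasures_convexCombo h₁ h₂ h))
    ((((hg.tendsto hT h₁).const_mul a.toReal).add
      ((hg.tendsto hT h₂).const_mul b.toReal)).congr fun n => ?_)
  rw [integral_convexCombo ha hb h (g n)]
  ring

theorem upperSemicontinuousOn (hT : Continuous T) (hg : IsNearBirkhoff T g f δ) :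
    UpperSemicontinuousOn (asympAverage g) (invariantMeasures T) :=
  upperSemicontinuousOn_ciInf (fun _ hν => hg.bddBelow hT hν) fun n =>
    ((ProbabilityMeasure.continuous_integral_continuousMap (g n)).const_mul
      _).upperSemicontinuous.upperSemicontinuousOn _

/-- The asymptotic average of `g` is maximised by an ergodic measure. -/
theorem exists_ergodic_isMaxOn (hT : Continuous T) (hg : IsNearBirkhoff T g f δ)
    (hne : (invariantMeasures T).Nonempty) :
    ∃ ν ∈ ergodicMeasures T, IsMaxOn (asympAverage g) (invariantMeasures T) ν := by
  have hM := isCompact_invariantMeasures hT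
  obtain ⟨ν₀, hν₀, hmax⟩ :=
    UpperSemicontinuousOn.exists_isMaxOn hne hM (hg.upperSemicontinuousOn hT)
  -- The maximisers form a compact face of the invariant measures. An extreme point of it, given by
  -- Krein–Milman, is extreme among all invariant measures, hence ergodic.
  set S : Set (ProbabilityMeasure X) :=
    {ν ∈ invariantMeasures T | asympAverage g ν₀ ≤ asympAverage g ν} with hSdef
  have hS : IsCompact S := by
    have hSeq : S = invariantMeasures T ∩ ⋂ n : ℕ+, {ν | asympAverage g ν₀ ≤
        (1 / ((n : ℕ) : ℝ)) * ∫ x, g n x ∂(ν : Measure X)} := by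
      ext ν
      simp only [hSdef, mem_ofPred_eq, mem_inter_iff, mem_iInter]
      exact and_congr_right fun hν => le_ciInf_iff (hg.bddBelow hT hν)
    rw [hSeq]
    exact hM.inter_right (isClosed_iInter fun n => isClosed_le continuous_const
      ((ProbabilityMeasure.continuous_integral_continuousMap (g n)).const_mul _))
  obtain ⟨_, hx⟩ := (hS.image continuous_integralDual).extremePoints_nonempty
    (Nonempty.image _ ⟨ν₀, hν₀, le_rfl⟩)
  obtain ⟨⟨ν, hν, rfl⟩, hext⟩ := mem_extremePoints_iff_left.1 hx
  refine ⟨ν, Ergodic.of_mem_extremePoints (mem_extremePoints_iff_left.2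
    ⟨⟨hν.1, inferInstance⟩, ?_⟩), fun ν' hν' => (hmax hν').trans hν.2⟩
  rintro m₁ ⟨hm₁, hp₁⟩ m₂ ⟨hm₂, hp₂⟩ ⟨a, b, ha, hb, hab, h⟩
  have ha' : a ≠ ∞ := ne_top_of_le_ne_top ENNReal.one_ne_top (hab ▸ le_self_add)
  have hb' : b ≠ ∞ := ne_top_of_le_ne_top ENNReal.one_ne_top (hab ▸ le_add_self)
  obtain ⟨m₁, rfl⟩ : ∃ m : ProbabilityMeasure X, (m : Measure X) = m₁ := ⟨⟨m₁, hp₁⟩, rfl⟩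
  obtain ⟨m₂, rfl⟩ : ∃ m : ProbabilityMeasure X, (m : Measure X) = m₂ := ⟨⟨m₂, hp₂⟩, rfl⟩
  have ha0 := ENNReal.toReal_pos ha.ne' ha'
  have hb0 := ENNReal.toReal_pos hb.ne' hb'
  have hab1 : a.toReal + b.toReal = 1 := by rw [← ENNReal.toReal_add ha' hb', hab]; simp
  have hcombo := hg.asympAverage_convexCombo hT hm₁ hm₂ ha' hb' h
  have h₁ : asympAverage g m₁ ≤ asympAverage g ν₀ := hmax hm₁
  have h₂ : asympAverage g m₂ ≤ asympAverage g ν₀ := hmax hm₂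
  have hν₀ν := hν.2
  -- The face property: if one component fell below the maximum, so would the weighted average.
  have hm₁S : m₁ ∈ S := ⟨hm₁, by
    by_contra! hlt
    have := mul_lt_mul_of_pos_left hlt ha0
    have := mul_le_mul_of_nonneg_left h₂ hb0.le
    have : (a.toReal + b.toReal) * asympAverage g ν₀ = asympAverage g ν₀ := by simp [hab1]
    nlinarith⟩
  have hm₂S : m₂ ∈ S := ⟨hm₂, by
    by_contra! hlt
    have := mul_lt_mul_of_pos_left hlt hb0
    have := mul_le_mul_of_nonneg_left h₁ ha0.le
    have : (a.toReal + b.toReal) * asympAverage g ν₀ = asympAverage g ν₀ := by simp [hab1]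
    nlinarith⟩
  have := hext _ ⟨m₁, hm₁S, rfl⟩ _ ⟨m₂, hm₂S, rfl⟩ ⟨a.toReal, b.toReal, ha0, hb0, hab1,
    (integralDual_convexCombo ha0.le hb0.le (by
      rwa [ENNReal.ofReal_toReal ha', ENNReal.ofReal_toReal hb'])).symm⟩
  exact congrArg Subtype.val (integralDual_injective this)

end IsNearBirkhoff

end Potential
-- Operator norm estimates.
section OpNorm

variable {d : ℕ}

theorem opNorm_nonneg (M : Matrix (Fin d) (Fin d) ℝ) : 0 ≤ opNorm M := norm_nonneg _

theorem opNorm_mul_le (M N : Matrix (Fin d) (Fin d) ℝ) :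
    opNorm (M * N) ≤ opNorm M * opNorm N := by
  rw [opNorm, map_mul]
  exact norm_mul_le _ _

theorem opNorm_sub_rev (M N : Matrix (Fin d) (Fin d) ℝ) : opNorm (M - N) = opNorm (N - M) := by
  simp only [opNorm, map_sub, norm_sub_rev]

theorem opNorm_le_add_sub (M N : Matrix (Fin d) (Fin d) ℝ) :
    opNorm N ≤ opNorm M + opNorm (M - N) := by
  rw [opNorm_sub_rev]
  simp only [opNorm, map_sub]
  exact norm_le_norm_add_norm_sub' _ _

theorem continuous_opNorm : Continuous (opNorm (d := d)) :=
  (LinearMap.continuous_of_finiteDimensional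
    (Matrix.toEuclideanCLM (n := Fin d) (𝕜 := ℝ)).toAlgEquiv.toLinearMap).norm

theorem opNorm_smul_one_le (c : ℝ) :
    opNorm (c • (1 : Matrix (Fin d) (Fin d) ℝ)) ≤ |c| := by
  rw [opNorm, map_smul, map_one, norm_smul, Real.norm_eq_abs]
  exact mul_le_of_le_one_right (abs_nonneg c) ContinuousLinearMap.norm_id_le

theorem opNorm_one (hd : 1 ≤ d) : opNorm (1 : Matrix (Fin d) (Fin d) ℝ) = 1 := by
  have : Nonempty (Fin d) := ⟨⟨0, hd⟩⟩
  rw [opNorm, map_one]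
  exact norm_one

/-- Converts upper bounds on the inverse into lower bounds on the norm. -/
theorem one_le_opNorm_mul_opNorm_inv (hd : 1 ≤ d) (G : GL (Fin d) ℝ) :
    1 ≤ opNorm (G : Matrix (Fin d) (Fin d) ℝ) *
      opNorm ((G⁻¹ : GL (Fin d) ℝ) : Matrix (Fin d) (Fin d) ℝ) := by
  have := opNorm_mul_le (G : Matrix (Fin d) (Fin d) ℝ)
    ((G⁻¹ : GL (Fin d) ℝ) : Matrix (Fin d) (Fin d) ℝ)
  rwa [← Units.val_mul, mul_inv_cancel, Units.val_one, opNorm_one hd] at this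

theorem opNorm_pos (hd : 1 ≤ d) (G : GL (Fin d) ℝ) :
    0 < opNorm (G : Matrix (Fin d) (Fin d) ℝ) :=
  pos_of_mul_pos_left (one_pos.trans_le (one_le_opNorm_mul_opNorm_inv hd G)) (opNorm_nonneg _)

end OpNorm

/-! ### Matrix cocycles close to scalar ones. -/

section Cocycle

variable {X : Type*} [TopologicalSpace X] {T : X → X} {d : ℕ}

theorem le_rho [CompactSpace X] (A B : C(X, GL (Fin d) ℝ)) (x : X) :
    opNorm ((A x : Matrix (Fin d) (Fin d) ℝ) - (B x : Matrix (Fin d) (Fin d) ℝ)) +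
      opNorm (((A x)⁻¹ : GL (Fin d) ℝ) - ((B x)⁻¹ : GL (Fin d) ℝ) :
        Matrix (Fin d) (Fin d) ℝ) ≤ rho A B := by
  have h : Continuous fun x => opNorm ((A x : Matrix (Fin d) (Fin d) ℝ) -
      (B x : Matrix (Fin d) (Fin d) ℝ)) +
      opNorm (((A x)⁻¹ : GL (Fin d) ℝ) - ((B x)⁻¹ : GL (Fin d) ℝ) :
        Matrix (Fin d) (Fin d) ℝ) :=
    (continuous_opNorm.comp ((Units.continuous_val.comp A.continuous).sub
      (Units.continuous_val.comp B.continuous))).add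
    (continuous_opNorm.comp ((Units.continuous_val.comp A.continuous.inv).sub
      (Units.continuous_val.comp B.continuous.inv)))
  exact le_ciSup (isCompact_range h).bddAbove x

/-- The scalar cocycle generator `x ↦ exp (f x) • 1`. -/
noncomputable def scalarCocycle (d : ℕ) (f : C(X, ℝ)) : C(X, GL (Fin d) ℝ) where
  toFun x :=
    { val := Real.exp (f x) • 1
      inv := Real.exp (-f x) • 1
      val_inv := by simp [smul_smul, ← Real.exp_add]
      inv_val := by simp [smul_smul, ← Real.exp_add] }
  continuous_toFun := Units.continuous_iff.2
    ⟨(Real.continuous_exp.comp f.continuous).smul continuous_const,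
      (Real.continuous_exp.comp f.continuous.neg).smul continuous_const⟩

theorem exp_add_le {R s δ ε : ℝ} (hs : |s| ≤ R) (hε : ε ≤ δ * Real.exp (-R)) (hδ : 0 ≤ δ) :
    Real.exp s + ε ≤ Real.exp (s + δ) := by
  have h1 : Real.exp (-R) ≤ Real.exp s := Real.exp_le_exp.2 (abs_le.1 hs).1
  have h2 : δ * Real.exp (-R) ≤ δ * Real.exp s := mul_le_mul_of_nonneg_left h1 hδ
  have h3 := mul_le_mul_of_nonneg_left (Real.add_one_le_exp δ) (Real.exp_pos s).le
  rw [Real.exp_add]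
  linarith

/-- Matrix cocycles close to a scalar cocycle have one-step growth close to that of the latter. -/
theorem exists_rho_lt_opNorm_le [CompactSpace X] (d : ℕ) (f : C(X, ℝ)) {δ : ℝ} (hδ : 0 < δ) :
    ∃ ε > 0, ∀ B : C(X, GL (Fin d) ℝ), rho (scalarCocycle d f) B < ε → ∀ x,
      opNorm (B x : Matrix (Fin d) (Fin d) ℝ) ≤ Real.exp (f x + δ) ∧
      opNorm (((B x)⁻¹ : GL (Fin d) ℝ) : Matrix (Fin d) (Fin d) ℝ) ≤ Real.exp (-f x + δ) := by
  -- Both `exp (f x)` and `exp (-f x)` are at least `exp (-‖f‖)`, so this absolute error is a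
  -- relative error of at most `δ` for each.
  refine ⟨δ * Real.exp (-‖f‖), by positivity, fun B hB x => ?_⟩
  have hρ := (le_rho (scalarCocycle d f) B x).trans hB.le
  have hf : |f x| ≤ ‖f‖ := f.norm_coe_le_norm x
  constructor
  · refine le_trans ?_ (exp_add_le hf le_rfl hδ.le)
    refine (opNorm_le_add_sub (scalarCocycle d f x : Matrix (Fin d) (Fin d) ℝ) _).trans
      (add_le_add ?_ (le_trans (le_add_of_nonneg_right (opNorm_nonneg _)) hρ))
    exact (opNorm_smul_one_le _).trans_eq (abs_of_pos (Real.exp_pos _))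
  · refine le_trans ?_ (exp_add_le ((abs_neg _).trans_le hf) le_rfl hδ.le)
    refine (opNorm_le_add_sub (((scalarCocycle d f x)⁻¹ : GL (Fin d) ℝ) :
      Matrix (Fin d) (Fin d) ℝ) _).trans
      (add_le_add ?_ (le_trans (le_add_of_nonneg_left (opNorm_nonneg _)) hρ))
    exact (opNorm_smul_one_le _).trans_eq (abs_of_pos (Real.exp_pos _))

theorem cocycle_add (A : C(X, GL (Fin d) ℝ)) (m n : ℕ) (x : X) :
    cocycle T A (m + n) x = cocycle T A m (T^[n] x) * cocycle T A n x := by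
  induction m with
  | zero => simp [cocycle]
  | succ m ih =>
    rw [Nat.succ_add, cocycle, cocycle, ih, mul_assoc, Function.iterate_add_apply]

theorem continuous_cocycle (hT : Continuous T) (A : C(X, GL (Fin d) ℝ)) (n : ℕ) :
    Continuous (cocycle T A n) := by
  induction n with
  | zero => exact continuous_const
  | succ n ih => exact (A.continuous.comp (hT.iterate n)).mul ih

/-- The functions `x ↦ log ‖A(n, x)‖`. -/
noncomputable def logNormCocycle (hd : 1 ≤ d) (hT : Continuous T) (A : C(X, GL (Fin d) ℝ)) (n : ℕ) :
    C(X, ℝ) where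
  toFun x := Real.log (opNorm (cocycle T A n x : Matrix (Fin d) (Fin d) ℝ))
  continuous_toFun := (continuous_opNorm.comp
    (Units.continuous_val.comp (continuous_cocycle hT A n))).log fun _ => (opNorm_pos hd _).ne'

theorem opNorm_cocycle_le (hd : 1 ≤ d) {B : C(X, GL (Fin d) ℝ)} {f : X → ℝ}
    (h : ∀ x, opNorm (B x : Matrix (Fin d) (Fin d) ℝ) ≤ Real.exp (f x)) (n : ℕ) (x : X) :
    opNorm (cocycle T B n x : Matrix (Fin d) (Fin d) ℝ) ≤ Real.exp (birkhoffSum T f n x) := by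
  induction n with
  | zero => simp [cocycle, opNorm_one hd]
  | succ n ih =>
    rw [cocycle, Units.val_mul, birkhoffSum_succ, add_comm, Real.exp_add]
    exact (opNorm_mul_le _ _).trans
      (mul_le_mul (h _) ih (opNorm_nonneg _) (Real.exp_pos _).le)

theorem opNorm_cocycle_inv_le (hd : 1 ≤ d) {B : C(X, GL (Fin d) ℝ)} {f : X → ℝ}
    (h : ∀ x, opNorm (((B x)⁻¹ : GL (Fin d) ℝ) : Matrix (Fin d) (Fin d) ℝ) ≤ Real.exp (f x))
    (n : ℕ) (x : X) :
    opNorm (((cocycle T B n x)⁻¹ : GL (Fin d) ℝ) : Matrix (Fin d) (Fin d) ℝ) ≤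
      Real.exp (birkhoffSum T f n x) := by
  induction n with
  | zero => simp [cocycle, opNorm_one hd]
  | succ n ih =>
    rw [cocycle, mul_inv_rev, Units.val_mul, birkhoffSum_succ, Real.exp_add]
    exact (opNorm_mul_le _ _).trans
      (mul_le_mul ih (h _) (opNorm_nonneg _) (Real.exp_pos _).le)

omit [TopologicalSpace X] in
theorem birkhoffSum_add_const (f : X → ℝ) (δ : ℝ) (n : ℕ) (x : X) :
    birkhoffSum T (fun y => f y + δ) n x = birkhoffSum T f n x + n * δ := by
  simp [birkhoffSum, Finset.sum_add_distrib]

theorem mem_maximisingMeasures_of_isMaxOn [MeasurableSpace X] {A : C(X, GL (Fin d) ℝ)}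
    {ν : ProbabilityMeasure X} (hν : ν ∈ invariantMeasures T)
    (h : IsMaxOn (lyapunovExponent T A) (invariantMeasures T) ν) : ν ∈ maximisingMeasures T A := by
  have : Nonempty (invariantMeasures T) := ⟨⟨ν, hν⟩⟩
  refine ⟨hν, le_antisymm ?_ (ciSup_le fun ν' => h ν'.2)⟩
  refine le_ciSup (f := fun ν' : invariantMeasures T => lyapunovExponent T A ν') ?_ ⟨ν, hν⟩
  -- The maximum itself bounds the family, so the real supremum is not a default value.
  exact ⟨_, by rintro _ ⟨ν', rfl⟩; exact h ν'.2⟩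

end Cocycle

theorem isNearBirkhoff_logNormCocycle {X : Type*} [MetricSpace X] [CompactSpace X] {T : X → X}
    {d : ℕ} (hd : 1 ≤ d) (hT : Continuous T) {B : C(X, GL (Fin d) ℝ)}
    {f : C(X, ℝ)} {δ : ℝ}
    (h : ∀ x, opNorm (B x : Matrix (Fin d) (Fin d) ℝ) ≤ Real.exp (f x + δ) ∧
      opNorm (((B x)⁻¹ : GL (Fin d) ℝ) : Matrix (Fin d) (Fin d) ℝ) ≤ Real.exp (-f x + δ)) :
    IsNearBirkhoff T (logNormCocycle hd hT B) f δ where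
  subadditive m n x := by
    change Real.log _ ≤ Real.log _ + Real.log _
    rw [← Real.log_mul (opNorm_pos hd _).ne' (opNorm_pos hd _).ne', cocycle_add, Units.val_mul]
    refine Real.log_le_log ?_ (opNorm_mul_le _ _)
    rw [← Units.val_mul]
    exact opNorm_pos hd _
  near n x := by
    change |Real.log _ - _| ≤ _
    have h1 := opNorm_cocycle_le (T := T) hd (fun y => (h y).1) n x
    have h2 := opNorm_cocycle_inv_le (T := T) hd (fun y => (h y).2) n x
    rw [birkhoffSum_add_const] at h1 h2
    have hneg : birkhoffSum T (fun y => -f y) n x = -birkhoffSum T f n x := by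
      simp [birkhoffSum]
    rw [hneg] at h2
    -- This gives `log ‖B(n,x)‖ ≥ -log ‖B(n,x)⁻¹‖`, the lower half of the estimate.
    have h3 := Real.log_nonneg (one_le_opNorm_mul_opNorm_inv hd (cocycle T B n x))
    rw [Real.log_mul (opNorm_pos hd _).ne' (opNorm_pos hd _).ne'] at h3
    rw [← Real.log_le_iff_le_exp (opNorm_pos hd _)] at h1 h2
    rw [abs_le]
    constructor <;> linarith

end LyapunovOpt

/-! ### The density theorem. -/

open LyapunovOpt in
theorem corollaryA {X : Type*} [MetricSpace X] [CompactSpace X] [MeasurableSpace X]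
    [BorelSpace X] (T : X → X) (hT : Continuous T) (d : ℕ) (hd : 1 ≤ d)
    (𝓕 : Set C(X, GL (Fin d) ℝ)) (h𝓕 : LyapunovOpt.RhoDense 𝓕) :
    Dense {μ : LyapunovOpt.ergodicMeasures T |
      (μ : ProbabilityMeasure X) ∈ ⋃ A ∈ 𝓕, LyapunovOpt.maximisingMeasures T A} := by
  refine dense_iff_inter_open.2 ?_
  rintro _ ⟨U, hU, rfl⟩ ⟨⟨μ, hμ⟩, hμU⟩
  obtain ⟨f, c, hc, hf⟩ := exists_separating_continuousMap hT hμ hU hμU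
  -- One `δ` is lost at `μ` and one at the maximiser `ν`; a third of the gap leaves room for both.
  obtain ⟨δ, hδ0, hδ⟩ : ∃ δ : ℝ, 0 < δ ∧ c + 2 * δ < ∫ x, f x ∂(μ : Measure X) :=
    ⟨(∫ x, f x ∂(μ : Measure X) - c) / 3, by linarith, by linarith⟩
  obtain ⟨ε, hε, hB⟩ := exists_rho_lt_opNorm_le d f hδ0
  obtain ⟨B, hB𝓕, hBρ⟩ := h𝓕 (scalarCocycle d f) ε hε
  have hnear := isNearBirkhoff_logNormCocycle hd hT (hB B hBρ)
  have hμM : μ ∈ invariantMeasures T := hμ.toMeasurePreserving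
  obtain ⟨ν, hν, hmax⟩ := hnear.exists_ergodic_isMaxOn hT ⟨μ, hμM⟩
  have hνM : ν ∈ invariantMeasures T := hν.toMeasurePreserving
  have hle : asympAverage (logNormCocycle hd hT B) μ ≤
    asympAverage (logNormCocycle hd hT B) ν := hmax hμM
  have h1 := (abs_le.1 (hnear.abs_asympAverage_sub_le hT hμM)).1
  have h2 := (abs_le.1 (hnear.abs_asympAverage_sub_le hT hνM)).2
  -- With `Λ` the exponent of `B`: `∫ f dν ≥ Λ(ν) - δ ≥ Λ(μ) - δ ≥ ∫ f dμ - 2δ > c`.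
  exact ⟨⟨ν, hν⟩, hf ν hνM (by linarith),
    Set.mem_iUnion₂.2 ⟨B, hB𝓕, mem_maximisingMeasures_of_isMaxOn hνM hmax⟩⟩
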